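/- Let $d\ge 0$, let $U\subseteq\mathbb C^d$ be a bounded domain (a nonempty connected bounded open set), and let $\mathcal H$ be a Hilbert space of holomorphic functions on $U$ with bounded point evaluations and reproducing kernel $k$, so that $k_\lambda\in\mathcal H$ and $\langle f,k_\lambda\rangle=f(\lambda)$ for $f\in\mathcal H$, $\lambda\in U$. Assume that $k$ is positive definite (for distinct $\lambda_1,\dots,\lambda_n\in U$ the matrix $[k_{\lambda_i}(\lambda_j)]$ is positive definite) and that $k$ is regular, i.e. that 1. $M^r\mathcal H\subseteq\mathcal H$ for $1\le r\le d$, where $(M^rf)(\lambda)=\lambda^rf(\lambda)$ and $\lambda^r$ is the $r$-th coordinate of $\lambda$ (so that $M=(M^1,\dots,M^d)$ is a commuting tuple of bounded operators); 2. the Taylor spectrum $\sigma(M)$ is contained in the closure of $U$; 3. the essential Taylor spectrum $\sigma_e(M)$ is contained in $\partial U$; 4. $\dim\bigcap_{r=1}^d\ker(\lambda^r-M^r)^*=1$ for every $\lambda\in U$. Let $m$ be a positive integer and $\mathcal M_m(\mathbb C)$ the $m\times m$ complex matrices with the operator norm. *Holomorphic interpolation.* $k$ is a holomorphic $m$-interpolation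 kernel on $U$ if for every positive integer $n$, all distinct $\lambda_1,\dots,\lambda_n\in U$ and all $z_1,\dots,z_n\in\mathcal M_m(\mathbb C)$ the following are equivalent: (i) there is a holomorphic $\varphi:U\to\mathcal M_m(\mathbb C)$ with $\varphi\cdot(\mathbb C^m\otimes\mathcal H)\subseteq\mathbb C^m\otimes\mathcal H$, with $\varphi(\lambda_i)=z_i$ for all $i$, and such that the operator $f\mapsto\varphi f$ on $\mathbb C^m\otimes\mathcal H$ has norm at most $1$; (ii) the $mn\times mn$ block matrix $[(1-z_jz_i^*)k_{\lambda_i}(\lambda_j)]$ is positive semidefinite, in the sense that $\sum_{i,j}\langle(1-z_jz_i^*)a_i,a_j\rangle\,k_{\lambda_i}(\lambda_j)\ge 0$ for all $a_1,\dots,a_n\in\mathbb C^m$. *Discrete interpolation.* Let $N=\{1,\dots,n\}$. A function $g:N\times N\to\mathbb C$ is a kernel on $N$ if $(g(i,j))_{i,j\in N}$ is positive semidefinite and $(g(i,j))_{i,j\in spt(g)}$ is positive definite, where $spt(g)=\{i: g(i,i)\ne0\}$. For $I\subseteq N$ let $H_{g,m}(I)$ be the Hilbert space of formal sums $\sum_{i\in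 I\cap spt(g)}a_ig_i$, $a_i\in\mathbb C^m$, with $\langle\sum_i b_ig_i,\sum_j c_jg_j\rangle=\sum_{i,j}g(i,j)\langle b_i,c_j\rangle$, and for $z:I\to\mathcal M_m(\mathbb C)$ let $T_{g,z}$ be the operator on $H_{g,m}(I)$ with $T_{g,z}(ag_i)=(z(i)^*a)g_i$ for $a\in\mathbb C^m$, $i\in I\cap spt(g)$. Then $g$ is a discrete $m$-interpolation kernel on $N$ if it is a kernel on $N$ and, for all $I\subseteq N$ and all $z:I\to\mathcal M_m(\mathbb C)$, $$\|T_{g,z}\|=\inf\{\|T_{g,\tilde z}\|:\ \tilde z:N\to\mathcal M_m(\mathbb C),\ \tilde z|_I=z\}.$$ **Proposition.** $k$ is a holomorphic $m$-interpolation kernel on $U$ if and only if for every positive integer $n$ and every choice of distinct points $\lambda_1,\dots,\lambda_n\in U$ the function $g(i,j)=k_{\lambda_i}(\lambda_j)$, $1\le i,j\le n$, is a discrete $m$-interpolation kernel on $N=\{1,\dots,n\}$. -/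

import Mathlib

open scoped ComplexOrder Matrix

noncomputable section

/-! ### Taylor spectrum and essential Taylor spectrum of a tuple of operators -/

section Taylor

variable {d : ℕ} {H : Type*} [NormedAddCommGroup H] [InnerProductSpace ℂ H]

/-- The differential `∑ r, T r ⊗ (e_r ∧ ·)` of the Koszul complex of a `d`-tuple `T`, on the total
space `H ⊗ Λ(ℂ^d)`. The component at `S = {i₁ < ⋯ < i_p}` is the coefficient of
`e_{i₁} ∧ ⋯ ∧ e_{i_p}`; the sign is that of moving `e_i` to its place in `S`. -/
def koszulDiff (T : Fin d → H →L[ℂ] H) :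
    (Finset (Fin d) → H) →ₗ[ℂ] (Finset (Fin d) → H) where
  toFun x := fun S => ∑ i ∈ S, (-1 : ℂ) ^ (S.filter (fun j => j < i)).card • T i (x (S.erase i))
  map_add' x y := by
    funext S
    simp [smul_add, Finset.sum_add_distrib]
  map_smul' c x := by
    funext S
    simp [Finset.smul_sum, smul_comm c]

/-- The tuple `(μ^r - T^r)_r`. -/
def shiftTuple (T : Fin d → H →L[ℂ] H) (μ : Fin d → ℂ) : Fin d → H →L[ℂ] H :=
  fun r => μ r • ContinuousLinearMap.id ℂ H - T r

/-- The Taylor spectrum: the points `μ` at which the Koszul complex of `μ - T` is not exact. -/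
def taylorSpectrum (T : Fin d → H →L[ℂ] H) : Set (Fin d → ℂ) :=
  {μ | LinearMap.ker (koszulDiff (shiftTuple T μ)) ≠
    LinearMap.range (koszulDiff (shiftTuple T μ))}

/-- The essential Taylor spectrum: the points `μ` at which `μ - T` is not Fredholm, that is, at
which the (total) cohomology of the Koszul complex of `μ - T` is infinite dimensional. -/
def essentialTaylorSpectrum (T : Fin d → H →L[ℂ] H) : Set (Fin d → ℂ) :=
  {μ | ¬ FiniteDimensional ℂ
    (LinearMap.ker (koszulDiff (shiftTuple T μ)) ⧸
      (LinearMap.range (koszulDiff (shiftTuple T μ))).submoduleOf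
        (LinearMap.ker (koszulDiff (shiftTuple T μ))))}

end Taylor

/-! ### Operators defined by a formula on function spaces -/

section ClosedGraph

variable {E F Y : Type*} [NormedAddCommGroup E] [NormedSpace ℂ E] [CompleteSpace E]
  [NormedAddCommGroup F] [NormedSpace ℂ F] [CompleteSpace F]
  [AddCommGroup Y] [Module ℂ Y] [TopologicalSpace Y] [T2Space Y]

/-- If `J : F → Y` is a continuous linear injection (elements of `F` "are" elements of `Y`) and the
continuous linear map `L : E → Y` takes its values in the image of `J`, this is `L` regarded as an
operator `E → F`. It is bounded by the closed graph theorem. -/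
def corestrictCLM (J : F →L[ℂ] Y) (hJ : Function.Injective J) (L : E →L[ℂ] Y)
    (hL : ∀ e, ∃ f, J f = L e) : E →L[ℂ] F :=
  ContinuousLinearMap.ofIsClosedGraph
    (g := { toFun := fun e => (hL e).choose
            map_add' := fun e e' => hJ ((hL (e + e')).choose_spec.trans (by
              rw [map_add, map_add, (hL e).choose_spec, (hL e').choose_spec]))
            map_smul' := fun c e => hJ ((hL (c • e)).choose_spec.trans (by
              rw [RingHom.id_apply, map_smul, map_smul, (hL e).choose_spec])) })
    (by
      have : IsClosed {p : E × F | J p.2 = L p.1} :=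
        isClosed_eq (J.continuous.comp continuous_snd) (L.continuous.comp continuous_fst)
      convert this using 1
      ext ⟨e, f⟩
      simp only [SetLike.mem_coe, LinearMap.mem_graph_iff, LinearMap.coe_mk, AddHom.coe_mk,
        Set.mem_ofPred_eq]
      constructor
      · rintro rfl
        exact (hL e).choose_spec
      · intro h
        exact hJ (h.trans (hL e).choose_spec.symm))

theorem corestrictCLM_spec (J : F →L[ℂ] Y) (hJ : Function.Injective J) (L : E →L[ℂ] Y)
    (hL : ∀ e, ∃ f, J f = L e) (e : E) : J (corestrictCLM J hJ L hL e) = L e :=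
  (hL e).choose_spec

end ClosedGraph

/-! ### Hilbert spaces of holomorphic functions, regularity -/

section Holomorphic

variable {d : ℕ} {U : Set (Fin d → ℂ)}

/-- A function defined on `U` only is holomorphic (for `U` open). -/
def IsHolomorphic (f : U → ℂ) : Prop :=
  ∃ F : (Fin d → ℂ) → ℂ, DifferentiableOn ℂ F U ∧ ∀ x : U, F x = f x

variable (H : Type*) [NormedAddCommGroup H] [InnerProductSpace ℂ H] [CompleteSpace H]
  [RKHS ℂ H U ℂ]

/-- The reproducing kernel, `reproducingKernel H l μ = k_l(μ)`, where `k_l ∈ H` satisfies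
`⟨f, k_l⟩ = f(l)` for all `f ∈ H`. It is conjugate-analytic in `l`. -/
def reproducingKernel (l μ : U) : ℂ := RKHS.kerFun H l (1 : ℂ) μ

/-- `f ↦ (l ↦ l^r f(l))`, as a map from `H` to functions on `U`. -/
def coordinateTimes (r : Fin d) : H →L[ℂ] (U → ℂ) :=
  ContinuousLinearMap.pi fun l : U =>
    (l : Fin d → ℂ) r • (ContinuousLinearMap.proj l ∘L RKHS.coeCLM (H := H) ℂ)

/-- `H` is invariant under multiplication by the coordinate functions. -/
def CoordinateInvariant : Prop :=
  ∀ (r : Fin d) (f : H), ∃ h : H, ∀ l : U, h l = (l : Fin d → ℂ) r * f l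

variable {H} in
/-- The tuple `M = (M^r)` of multiplications by the coordinate functions, as bounded operators. -/
def coordinateTuple (hM : CoordinateInvariant (U := U) H) (r : Fin d) : H →L[ℂ] H :=
  corestrictCLM (RKHS.coeCLM (H := H) ℂ) RKHS.coeCLM_injective (coordinateTimes H r)
    (fun f => (hM r f).imp fun _ hh => funext hh)

variable {H} in
theorem coordinateTuple_apply (hM : CoordinateInvariant (U := U) H) (r : Fin d) (f : H) (l : U) :
    coordinateTuple hM r f l = (l : Fin d → ℂ) r * f l :=
  congrFun (corestrictCLM_spec (RKHS.coeCLM (H := H) ℂ) RKHS.coeCLM_injective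
    (coordinateTimes H r) _ f) l

/-- `H` is a regular Hilbert space of holomorphic functions on `U`, with positive definite
reproducing kernel. -/
structure IsRegularSpace : Prop where
  /-- the elements of `H` are holomorphic functions -/
  holomorphic : ∀ f : H, IsHolomorphic (fun l : U => f l)
  /-- the kernel is (strictly) positive definite on `U` -/
  posDef : (Matrix.of (reproducingKernel (U := U) H)).PosDef
  /-- `M^r H ⊆ H` for every `r` -/
  invariant : CoordinateInvariant (U := U) H
  /-- `σ(M) ⊆ cl U` -/
  taylor : taylorSpectrum (coordinateTuple invariant) ⊆ closure U
  /-- `σ_e(M) ⊆ ∂U` -/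
  essential : essentialTaylorSpectrum (coordinateTuple invariant) ⊆ frontier U
  /-- `⋂ r, ker (l^r - M^r)^*` is one-dimensional for every `l ∈ U` -/
  sharp : ∀ l : U, Module.finrank ℂ
    (⨅ r : Fin d, LinearMap.ker
      (ContinuousLinearMap.adjoint
        (shiftTuple (coordinateTuple invariant) (l : Fin d → ℂ) r)).toLinearMap : Submodule ℂ H) = 1

/-! ### Matrix-valued multipliers and holomorphic interpolation kernels -/

/-- `ℂ^m ⊗ H`, realised as `m`-tuples `f = (f_1, …, f_m)` of elements of `H` with
`‖f‖² = ∑ ‖f_a‖²`. -/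
abbrev VectorSpaceOf (m : ℕ) : Type _ := PiLp 2 (fun _ : Fin m => H)

/-- The elements of `ℂ^m ⊗ H` as `ℂ^m`-valued functions on `U`. -/
def vectorEval (m : ℕ) : VectorSpaceOf H m →L[ℂ] (U → Fin m → ℂ) :=
  ContinuousLinearMap.pi fun l : U => ContinuousLinearMap.pi fun a : Fin m =>
    ContinuousLinearMap.proj l ∘L RKHS.coeCLM (H := H) ℂ ∘L PiLp.proj 2 (fun _ : Fin m => H) a

theorem vectorEval_injective (m : ℕ) : Function.Injective (vectorEval (U := U) H m) := by
  intro f g h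
  refine PiLp.ext fun a => RKHS.ext fun l => ?_
  exact congrFun (congrFun h l) a

variable {H} in
/-- `f ↦ φ f`, `(φ f)(l) = φ(l) f(l)`, as a map from `ℂ^m ⊗ H` to functions on `U`. -/
def matrixTimes {m : ℕ} (φ : U → Matrix (Fin m) (Fin m) ℂ) :
    VectorSpaceOf H m →L[ℂ] (U → Fin m → ℂ) :=
  ContinuousLinearMap.pi fun l : U =>
    (Matrix.toLin' (φ l)).toContinuousLinearMap ∘L ContinuousLinearMap.proj l ∘L
      vectorEval (U := U) H m

theorem matrixTimes_apply {m : ℕ} (φ : U → Matrix (Fin m) (Fin m) ℂ) (f : VectorSpaceOf H m)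
    (l : U) : matrixTimes φ f l = φ l *ᵥ vectorEval H m f l := by
  simp [matrixTimes]

/-- `φ` is a holomorphic `M_m(ℂ)`-valued function that multiplies `ℂ^m ⊗ H` into itself, that is,
`φ` is an element of the algebra `H^∞_{k,m}`. -/
structure IsMatrixMultiplier {m : ℕ} (φ : U → Matrix (Fin m) (Fin m) ℂ) : Prop where
  holomorphic : ∀ a b, IsHolomorphic (fun l : U => φ l a b)
  maps : ∀ f : VectorSpaceOf H m, ∃ h : VectorSpaceOf H m,
    ∀ l : U, vectorEval H m h l = φ l *ᵥ vectorEval H m f l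

variable {H} in
/-- The bounded operator `f ↦ φ f` on `ℂ^m ⊗ H`; its norm is the multiplier norm of `φ`. -/
def multiplicationOperator {m : ℕ} {φ : U → Matrix (Fin m) (Fin m) ℂ}
    (hφ : IsMatrixMultiplier H φ) : VectorSpaceOf H m →L[ℂ] VectorSpaceOf H m :=
  corestrictCLM (vectorEval (U := U) H m) (vectorEval_injective H m) (matrixTimes φ)
    (fun f => (hφ.maps f).imp fun _ hh => funext fun l =>
      (hh l).trans (matrixTimes_apply H φ f l).symm)

variable {H} in
theorem multiplicationOperator_apply {m : ℕ} {φ : U → Matrix (Fin m) (Fin m) ℂ}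
    (hφ : IsMatrixMultiplier H φ) (f : VectorSpaceOf H m) (l : U) :
    vectorEval H m (multiplicationOperator hφ f) l = φ l *ᵥ vectorEval H m f l := by
  rw [multiplicationOperator, corestrictCLM_spec, matrixTimes_apply]

/-- The `mn × mn` block matrix `[(1 - z_j z_i^*) k_{l_i}(l_j)]`. The `(i, j)` term is the block that
takes the `i`-th to the `j`-th copy of `ℂ^m`, i.e. the associated quadratic form is
`∑_{i,j} ⟨(1 - z_j z_i^*) a_i, a_j⟩ k_{l_i}(l_j)`. -/
def pickMatrix {m n : ℕ} (l : Fin n → U) (z : Fin n → Matrix (Fin m) (Fin m) ℂ) :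
    Matrix (Fin n × Fin m) (Fin n × Fin m) ℂ :=
  Matrix.of fun p q =>
    (1 - z p.1 * (z q.1)ᴴ) p.2 q.2 * reproducingKernel H (l q.1) (l p.1)

/-- The reproducing kernel of `H` is a holomorphic `m`-interpolation kernel on `U`. -/
def IsHolomorphicInterpolationKernel (m : ℕ) : Prop :=
  ∀ n : ℕ, 0 < n → ∀ l : Fin n → U, Function.Injective l →
    ∀ z : Fin n → Matrix (Fin m) (Fin m) ℂ,
      (∃ (φ : U → Matrix (Fin m) (Fin m) ℂ) (hφ : IsMatrixMultiplier H φ),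
        ‖multiplicationOperator hφ‖ ≤ 1 ∧ ∀ i, φ (l i) = z i) ↔
      (pickMatrix H l z).PosSemidef

end Holomorphic

/-! ### Discrete kernels and discrete interpolation kernels -/

section Discrete

variable {n : ℕ}

/-- `I ∩ spt(g)`, where `spt(g) = {i : g(i,i) ≠ 0}`. -/
abbrev SupportIn (g : Fin n → Fin n → ℂ) (I : Set (Fin n)) : Type :=
  {i : Fin n // i ∈ I ∧ g i i ≠ 0}

instance (g : Fin n → Fin n → ℂ) (I : Set (Fin n)) : Fintype (SupportIn g I) :=
  Fintype.ofFinite _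

/-- `g` is a kernel on `N = {1, …, n}`: it is positive semidefinite, and positive definite on its
support. -/
structure IsDiscreteKernel (g : Fin n → Fin n → ℂ) : Prop where
  posSemidef : (Matrix.of g).PosSemidef
  posDef : (Matrix.of fun i j : SupportIn g Set.univ => g i j).PosDef

/-- The Hilbert space `H_{g,m}(I) ⊆ ℂ^m ⊗ H_g` spanned by the vectors `a g_i`, `a ∈ ℂ^m`,
`i ∈ I ∩ spt(g)`: its elements are the formal sums `∑ a_i g_i` over `i ∈ I ∩ spt(g)`, given by their
coefficients `a_i ∈ ℂ^m`. -/
def DiscreteSpace {g : Fin n → Fin n → ℂ} (_hg : IsDiscreteKernel g) (m : ℕ)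
    (I : Set (Fin n)) : Type :=
  SupportIn g I → EuclideanSpace ℂ (Fin m)

variable {g : Fin n → Fin n → ℂ} (hg : IsDiscreteKernel g) (m : ℕ) (I : Set (Fin n))

instance : AddCommGroup (DiscreteSpace hg m I) :=
  inferInstanceAs (AddCommGroup (SupportIn g I → EuclideanSpace ℂ (Fin m)))

instance : Module ℂ (DiscreteSpace hg m I) :=
  inferInstanceAs (Module ℂ (SupportIn g I → EuclideanSpace ℂ (Fin m)))

instance : FiniteDimensional ℂ (DiscreteSpace hg m I) :=
  inferInstanceAs (FiniteDimensional ℂ (SupportIn g I → EuclideanSpace ℂ (Fin m)))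

theorem IsDiscreteKernel.posDef_supportIn (hg : IsDiscreteKernel g) (I : Set (Fin n)) :
    (Matrix.of fun i j : SupportIn g I => g i j).PosDef :=
  hg.posDef.submatrix (e := fun i : SupportIn g I => ⟨i.1, Set.mem_univ _, i.2.2⟩)
    (fun _ _ h => Subtype.ext (congrArg (fun x => x.1) h))

/-- The inner product of `∑ b_i g_i` and `∑ c_j g_j`, in this order and linear in the first of them,
is `∑_{i,j} g(i,j) ⟨b_i, c_j⟩`. (The first argument of Mathlib's `inner` is the conjugate-linear
one, so the roles of `b` and `c` are `inner ℂ c b` below.) -/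
def discreteInner (c b : DiscreteSpace hg m I) : ℂ :=
  ∑ i : SupportIn g I, ∑ j : SupportIn g I,
    g i j * inner ℂ (show EuclideanSpace ℂ (Fin m) from c j) (b i)

theorem discreteInner_self (c : DiscreteSpace hg m I) :
    discreteInner hg m I c c = ∑ r : Fin m,
      (star (fun i : SupportIn g I => star ((show EuclideanSpace ℂ (Fin m) from c i) r)) ⬝ᵥ
        ((Matrix.of fun i j : SupportIn g I => g i j) *ᵥ
          (fun i : SupportIn g I => star ((show EuclideanSpace ℂ (Fin m) from c i) r)))) := by
  simp only [discreteInner, dotProduct, Matrix.mulVec, Finset.mul_sum, PiLp.inner_apply]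
  conv_rhs => rw [Finset.sum_comm]
  refine Finset.sum_congr rfl fun i _ => ?_
  conv_rhs => rw [Finset.sum_comm]
  refine Finset.sum_congr rfl fun j _ => Finset.sum_congr rfl fun r _ => ?_
  simp only [RCLike.inner_apply, Pi.star_apply, star_star, Matrix.of_apply]
  rw [starRingEnd_apply]
  ring

instance discreteCore : InnerProductSpace.Core ℂ (DiscreteSpace hg m I) where
  inner := discreteInner hg m I
  conj_inner_symm c b := by
    have hH : ∀ i j : SupportIn g I, star (g i j) = g j i := fun i j =>
      (hg.posDef_supportIn I).1.apply j i
    simp only [discreteInner, map_sum, map_mul, inner_conj_symm]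
    rw [Finset.sum_comm]
    refine Finset.sum_congr rfl fun i _ => Finset.sum_congr rfl fun j _ => ?_
    exact congrArg (· * _) (hH j i)
  re_inner_nonneg c := by
    rw [discreteInner_self, map_sum]
    refine Finset.sum_nonneg fun r _ => ?_
    exact (Complex.le_def.1
      ((hg.posDef_supportIn I).posSemidef.dotProduct_mulVec_nonneg _)).1
  add_left c c' b := by
    simp only [discreteInner, ← Finset.sum_add_distrib, ← mul_add]
    refine Finset.sum_congr rfl fun i _ => Finset.sum_congr rfl fun j _ => ?_
    exact congrArg (_ * ·) (inner_add_left (c j : EuclideanSpace ℂ (Fin m)) (c' j) (b i))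
  smul_left c b r := by
    simp only [discreteInner, Finset.mul_sum]
    refine Finset.sum_congr rfl fun i _ => Finset.sum_congr rfl fun j _ => ?_
    rw [mul_left_comm]
    exact congrArg (_ * ·) (inner_smul_left (c j : EuclideanSpace ℂ (Fin m)) (b i) r)
  definite c hc := by
    have hP := hg.posDef_supportIn I
    have h0 := (Finset.sum_eq_zero_iff_of_nonneg
      (fun r _ => hP.posSemidef.dotProduct_mulVec_nonneg _)).1
        ((discreteInner_self hg m I c).symm.trans hc)
    funext i
    refine PiLp.ext fun r => ?_
    by_contra hne
    refine (hP.dotProduct_mulVec_pos (x := fun i : SupportIn g I =>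
      star ((show EuclideanSpace ℂ (Fin m) from c i) r)) ?_).ne' (h0 r (Finset.mem_univ r))
    intro h
    exact hne (star_eq_zero.1 (congrFun h i))

instance : NormedAddCommGroup (DiscreteSpace hg m I) :=
  InnerProductSpace.Core.toNormedAddCommGroup (𝕜 := ℂ)

instance : InnerProductSpace ℂ (DiscreteSpace hg m I) :=
  InnerProductSpace.ofCore (discreteCore hg m I).toCore

variable {m I} in
/-- The operator `T_{g,z}` on `H_{g,m}(I)`, determined by `a g_i ↦ (z(i)^* a) g_i`. -/
def discreteOperator (z : I → Matrix (Fin m) (Fin m) ℂ) :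
    DiscreteSpace hg m I →L[ℂ] DiscreteSpace hg m I :=
  LinearMap.toContinuousLinearMap
    { toFun := fun c i => Matrix.toEuclideanLin (z ⟨i.1, i.2.1⟩)ᴴ (c i)
      map_add' := fun c c' => funext fun i => map_add _ (c i) (c' i)
      map_smul' := fun r c => funext fun i => map_smul _ r (c i) }

/-- `g` is a discrete `m`-interpolation kernel: it is a kernel, and
`‖T_{g,z}‖ = inf ‖T_{g,z'}‖` over all extensions `z'` of `z` to `N`, for all `I ⊆ N` and
`z : I → M_m(ℂ)`. -/
def IsDiscreteInterpolationKernel (g : Fin n → Fin n → ℂ) (m : ℕ) : Prop :=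
  ∃ hg : IsDiscreteKernel g, ∀ (I : Set (Fin n)) (z : I → Matrix (Fin m) (Fin m) ℂ),
    ‖discreteOperator hg z‖ =
      ⨅ z' : {w : Fin n → Matrix (Fin m) (Fin m) ℂ // ∀ i : I, w i = z i},
        ‖discreteOperator hg (fun i : (Set.univ : Set (Fin n)) => z'.1 i)‖

end Discrete

end

/-! Both kinds of interpolation reduce to one condition, `AdjointBound`: on the span of the vectors
`a ⊗ k_{l i}`, the map `a ⊗ k_{l i} ↦ (z i)ᴴ a ⊗ k_{l i}` has norm at most `c`. Expanding squared
norms shows that with `c = 1` this is positivity of the Pick matrix (`pickMatrix_posSemidef_iff`).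
Since `∑ a_i g_i ↦ ∑ a_i ⊗ k_{l i}` is an isometry, it is also the inequality `‖T_{g,z}‖ ≤ c`
(`norm_discreteOperator_univ_le_iff`). Finally, the adjoint of multiplication by `φ` acts on kernel
vectors by exactly this formula, so `φ` is a multiplier of norm at most `c` precisely when the bound
holds on every finite subset of `U`; holomorphy of `φ` is then automatic
(`adjointBound_of_multiplier`, `exists_multiplier_of_adjointBound`).

Holomorphic implies discrete: rescale the data on `I` to norm at most `1`, interpolate by a
multiplier, and evaluate it at the remaining points.

Discrete implies holomorphic: the infimum in the discrete condition allows an extension from the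
given nodes to any larger finite set at the cost of an arbitrarily small increase of `c`. The
entries of such extensions are uniformly bounded, so Tychonoff compactness over all finite sets and
all losses yields one function on `U` with the original bound (`exists_extension_to_domain`), and
this function is the required multiplier. The other half of the Pick condition, necessity, holds for
every multiplier. -/

/-- The element `a ⊗ k_l` of `ℂ^m ⊗ H`, as a linear function of `a`. -/
noncomputable def kernelVector {d : ℕ} {U : Set (Fin d → ℂ)} (H : Type*) [NormedAddCommGroup H]
    [InnerProductSpace ℂ H] [CompleteSpace H] [RKHS ℂ H U ℂ] (m : ℕ) (l : U) :
    EuclideanSpace ℂ (Fin m) →ₗ[ℂ] VectorSpaceOf H m where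
  toFun a := WithLp.toLp 2 fun r => RKHS.kerFun H l (a r)
  map_add' a b := by ext r : 1; simp
  map_smul' c a := by
    ext r : 1
    exact map_smul (RKHS.kerFun H l) c (a r)

/-! ### Kernel vectors and the adjoint bound -/

section KernelVector

variable {d : ℕ} {U : Set (Fin d → ℂ)} {H : Type*} [NormedAddCommGroup H]
  [InnerProductSpace ℂ H] [CompleteSpace H] [RKHS ℂ H U ℂ] {m : ℕ}

theorem inner_kernelVector (l : U) (a : EuclideanSpace ℂ (Fin m)) (f : VectorSpaceOf H m) :
    inner ℂ (kernelVector H m l a) f = inner ℂ a (WithLp.toLp 2 (vectorEval H m f l)) := by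
  simp only [PiLp.inner_apply, kernelVector, LinearMap.coe_mk, AddHom.coe_mk, RKHS.kerFun_inner]
  rfl

theorem kerFun_eq_smul (l : U) (c : ℂ) : RKHS.kerFun H l c = c • RKHS.kerFun H l (1 : ℂ) := by
  rw [← map_smul, smul_eq_mul, mul_one]

theorem inner_kernelVector_kernelVector (l μ : U) (a b : EuclideanSpace ℂ (Fin m)) :
    inner ℂ (kernelVector H m l a) (kernelVector H m μ b)
      = reproducingKernel H μ l * inner ℂ a b := by
  simp only [PiLp.inner_apply, kernelVector, LinearMap.coe_mk, AddHom.coe_mk, RKHS.kerFun_inner,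
    Finset.mul_sum]
  refine Finset.sum_congr rfl fun r _ => ?_
  rw [kerFun_eq_smul μ (b r), RKHS.coe_smul]
  simp only [Pi.smul_apply, smul_eq_mul, RCLike.inner_apply, reproducingKernel]
  ring

theorem star_reproducingKernel (l μ : U) :
    star (reproducingKernel H l μ) = reproducingKernel H μ l := by
  have h : ∀ x y : U, reproducingKernel H x y
      = inner ℂ (RKHS.kerFun H y (1 : ℂ)) (RKHS.kerFun H x (1 : ℂ)) := fun x y => by
    rw [RKHS.kerFun_inner]; simp [reproducingKernel]
  rw [h, h]
  exact inner_conj_symm _ _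

/-- The operator `a ⊗ k_{l i} ↦ (z i)ᴴ a ⊗ k_{l i}` on the span of the vectors `a ⊗ k_{l i}` has
norm at most `c`. -/
def AdjointBound (H : Type*) [NormedAddCommGroup H]
    [InnerProductSpace ℂ H] [CompleteSpace H] [RKHS ℂ H U ℂ] {ι : Type*} [Fintype ι] (c : ℝ)
    (l : ι → U) (z : ι → Matrix (Fin m) (Fin m) ℂ) : Prop :=
  ∀ a : ι → EuclideanSpace ℂ (Fin m),
    ‖∑ i, kernelVector H m (l i) (Matrix.toEuclideanLin (z i)ᴴ (a i))‖
      ≤ c * ‖∑ i, kernelVector H m (l i) (a i)‖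

/-- Coefficients on the smaller index set are extended by zero, which changes neither sum. -/
theorem AdjointBound.comp_injective {ι κ : Type*} [Fintype ι] [Fintype κ] {c : ℝ} {l : ι → U}
    {z : ι → Matrix (Fin m) (Fin m) ℂ} (h : AdjointBound H c l z) {e : κ → ι}
    (he : Function.Injective e) : AdjointBound H c (l ∘ e) (z ∘ e) := by
  classical
  intro a
  have key : ∀ F : ι → EuclideanSpace ℂ (Fin m) →ₗ[ℂ] VectorSpaceOf H m,
      ∑ i, F i (Function.extend e a 0 i) = ∑ k, F (e k) (a k) := fun F => by
    rw [← Finset.sum_subset (Finset.subset_univ (Finset.univ.map ⟨e, he⟩))]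
    · simp [he.extend_apply]
    · intro i _ hi
      rw [Function.extend_apply' _ _ _ (by simpa using hi)]
      simp
  have := h (Function.extend e a 0)
  rw [key (fun i => kernelVector H m (l i))] at this
  exact (key fun i => kernelVector H m (l i) ∘ₗ Matrix.toEuclideanLin (z i)ᴴ) ▸ this

theorem AdjointBound.smul {ι : Type*} [Fintype ι] {c : ℝ} {l : ι → U}
    {z : ι → Matrix (Fin m) (Fin m) ℂ} (h : AdjointBound H c l z) {r : ℝ} (hr : 0 ≤ r) :
    AdjointBound H (r * c) l (fun i => (r : ℂ) • z i) := by
  intro a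
  have h1 : ∀ i, kernelVector H m (l i) (Matrix.toEuclideanLin ((r : ℂ) • z i)ᴴ (a i))
      = (r : ℂ) • kernelVector H m (l i) (Matrix.toEuclideanLin (z i)ᴴ (a i)) := fun i => by
    rw [Matrix.conjTranspose_smul, Complex.star_def, Complex.conj_ofReal, map_smul,
      LinearMap.smul_apply, map_smul]
  simp only [h1, ← Finset.smul_sum, norm_smul, Complex.norm_real, Real.norm_of_nonneg hr, mul_assoc]
  exact mul_le_mul_of_nonneg_left (h a) hr

/-! ### The Pick matrix as an adjoint bound -/

theorem norm_sq_sum_kernelVector {ι : Type*} [Fintype ι] (l : ι → U)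
    (a : ι → EuclideanSpace ℂ (Fin m)) :
    ((‖∑ i, kernelVector H m (l i) (a i)‖ ^ 2 : ℝ) : ℂ)
      = ∑ j, ∑ i, reproducingKernel H (l i) (l j) * inner ℂ (a j) (a i) := by
  have := inner_self_eq_norm_sq_to_K (𝕜 := ℂ) (∑ i, kernelVector H m (l i) (a i))
  push_cast
  refine this.symm.trans ?_
  simp only [sum_inner, inner_sum, inner_kernelVector_kernelVector]
  exact Finset.sum_comm

/-- Blockwise, `⟨a_i, a_j⟩ - ⟨z_i^* a_i, z_j^* a_j⟩ = ⟨(1 - z_j z_i^*) a_i, a_j⟩`; weighting by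
`k_{l i}(l j)` and summing turns the two terms on the left into squared norms. -/
theorem pickMatrix_form {n : ℕ} (l : Fin n → U) (z : Fin n → Matrix (Fin m) (Fin m) ℂ)
    (a : Fin n → EuclideanSpace ℂ (Fin m)) :
    star (fun p : Fin n × Fin m => a p.1 p.2) ⬝ᵥ (pickMatrix H l z *ᵥ fun p => a p.1 p.2)
      = ((‖∑ i, kernelVector H m (l i) (a i)‖ ^ 2 -
        ‖∑ i, kernelVector H m (l i) (Matrix.toEuclideanLin (z i)ᴴ (a i))‖ ^ 2 : ℝ) : ℂ) := by
  rw [Complex.ofReal_sub, norm_sq_sum_kernelVector, norm_sq_sum_kernelVector]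
  have hdot : ∀ x y : EuclideanSpace ℂ (Fin m),
      inner ℂ x y = star x.ofLp ⬝ᵥ y.ofLp := fun x y => by
    rw [EuclideanSpace.inner_eq_star_dotProduct, dotProduct_comm]
  have hblock : ∀ i j, inner ℂ (a j) (a i) - inner ℂ (Matrix.toEuclideanLin (z j)ᴴ (a j))
      (Matrix.toEuclideanLin (z i)ᴴ (a i))
      = star (a j).ofLp ⬝ᵥ ((1 - z j * (z i)ᴴ) *ᵥ (a i).ofLp) := fun i j => by
    rw [hdot, hdot, Matrix.sub_mulVec, Matrix.one_mulVec, dotProduct_sub]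
    congr 1
    simp [Matrix.toLpLin_apply, Matrix.star_mulVec, Matrix.dotProduct_mulVec, Matrix.vecMul_vecMul]
  simp only [← Finset.sum_sub_distrib, ← mul_sub, hblock]
  simp only [dotProduct, Matrix.mulVec, Fintype.sum_prod_type, Finset.mul_sum, pickMatrix,
    Matrix.of_apply, Pi.star_apply]
  refine Finset.sum_congr rfl fun j _ => ?_
  rw [Finset.sum_comm]
  refine Finset.sum_congr rfl fun i _ => Finset.sum_congr rfl fun r _ =>
    Finset.sum_congr rfl fun s _ => ?_
  ring

theorem pickMatrix_posSemidef_iff {n : ℕ} (l : Fin n → U)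
    (z : Fin n → Matrix (Fin m) (Fin m) ℂ) :
    (pickMatrix H l z).PosSemidef ↔ AdjointBound H 1 l z := by
  rw [Matrix.posSemidef_iff_dotProduct_mulVec]
  constructor
  · rintro ⟨-, h⟩ a
    have := h fun p => a p.1 p.2
    rw [pickMatrix_form, Complex.zero_le_real, sub_nonneg] at this
    rw [one_mul]
    exact le_of_sq_le_sq this (norm_nonneg _)
  · refine fun h => ⟨?_, fun x => ?_⟩
    · ext p q
      have h1 : (1 - z q.1 * (z p.1)ᴴ)ᴴ = 1 - z p.1 * (z q.1)ᴴ := by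
        simp [Matrix.conjTranspose_sub, Matrix.conjTranspose_mul]
      rw [Matrix.conjTranspose_apply, pickMatrix, Matrix.of_apply, Matrix.of_apply, star_mul',
        star_reproducingKernel, ← Matrix.conjTranspose_apply, h1]
    · have := pickMatrix_form (H := H) l z fun i => WithLp.toLp 2 fun r => x (i, r)
      simp only [Prod.mk.eta] at this
      rw [this, Complex.zero_le_real, sub_nonneg]
      exact pow_le_pow_left₀ (norm_nonneg _) ((h _).trans_eq (one_mul _)) 2

/-! ### Multipliers and adjoint bounds -/

/-- Pairing with `a ⊗ k_l` is evaluation at `l` followed by pairing with `a`, so multiplication by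
`φ l` can be moved onto `a` as `(φ l)ᴴ`. -/
theorem adjoint_multiplicationOperator_kernelVector {φ : U → Matrix (Fin m) (Fin m) ℂ}
    (hφ : IsMatrixMultiplier H φ) (l : U) (a : EuclideanSpace ℂ (Fin m)) :
    ContinuousLinearMap.adjoint (multiplicationOperator hφ) (kernelVector H m l a)
      = kernelVector H m l (Matrix.toEuclideanLin (φ l)ᴴ a) := by
  refine ext_inner_right ℂ fun f => ?_
  rw [ContinuousLinearMap.adjoint_inner_left, inner_kernelVector, inner_kernelVector,
    multiplicationOperator_apply, Matrix.toEuclideanLin_conjTranspose_eq_adjoint,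
    LinearMap.adjoint_inner_left]
  rfl

theorem adjointBound_of_multiplier {φ : U → Matrix (Fin m) (Fin m) ℂ}
    (hφ : IsMatrixMultiplier H φ) {ι : Type*} [Fintype ι] (l : ι → U) :
    AdjointBound H ‖multiplicationOperator hφ‖ l (φ ∘ l) := by
  intro a
  simp only [Function.comp_apply, ← adjoint_multiplicationOperator_kernelVector hφ, ← map_sum]
  rw [← ContinuousLinearMap.adjoint.norm_map (multiplicationOperator hφ)]
  exact ContinuousLinearMap.le_opNorm _ _

/-- A vector orthogonal to every `a ⊗ k_l` vanishes at each point of `U`, hence is zero. -/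
theorem denseRange_kernelVector :
    DenseRange (Finsupp.lsum ℂ fun l : U => kernelVector H m l) := by
  rw [DenseRange, ← LinearMap.coe_range, Submodule.dense_iff_topologicalClosure_eq_top,
    Submodule.topologicalClosure_eq_top_iff, Submodule.eq_bot_iff]
  intro f hf
  refine vectorEval_injective (U := U) H m ?_
  rw [map_zero]
  funext l
  have : WithLp.toLp 2 (vectorEval H m f l) = (0 : EuclideanSpace ℂ (Fin m)) := by
    refine ext_inner_left ℂ fun a => ?_
    rw [← inner_kernelVector, inner_zero_right]
    exact hf _ ⟨Finsupp.single l a, by simp⟩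
  exact congrArg WithLp.ofLp this

/-- The operator is built from its adjoint `S`: the bound on finite sums makes `a ⊗ k_l ↦ (φ l)ᴴ a ⊗
k_l` well defined on a dense subspace and extends it by continuity. The reproducing property
identifies the adjoint of `S` with multiplication by `φ`. -/
theorem exists_operator_of_adjointBound {φ : U → Matrix (Fin m) (Fin m) ℂ} {c : ℝ} (hc : 0 ≤ c)
    (h : ∀ F : Finset U, AdjointBound H c (Subtype.val : F → U) (fun x => φ x)) :
    ∃ T : VectorSpaceOf H m →L[ℂ] VectorSpaceOf H m, ‖T‖ ≤ c ∧
      ∀ f l, vectorEval H m (T f) l = φ l *ᵥ vectorEval H m f l := by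
  obtain ⟨e, he⟩ : ∃ e, e = Finsupp.lsum ℂ fun l : U => kernelVector H m l := ⟨_, rfl⟩
  obtain ⟨g, hg⟩ : ∃ g, g = Finsupp.lsum ℂ fun l : U =>
    kernelVector H m l ∘ₗ Matrix.toEuclideanLin (φ l)ᴴ := ⟨_, rfl⟩
  have hdense : DenseRange e := he ▸ denseRange_kernelVector
  have hb : ∀ x, ‖g x‖ ≤ c * ‖e x‖ := fun x => by
    have := h x.support fun i => x i
    rw [Finset.sum_coe_sort x.support fun i => kernelVector H m i (x i),
      Finset.sum_coe_sort x.support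
        fun i => kernelVector H m i (Matrix.toEuclideanLin (φ i)ᴴ (x i))] at this
    rw [he, hg]
    exact this
  obtain ⟨S, hS⟩ : ∃ S, S = g.extendOfNorm e := ⟨_, rfl⟩
  refine ⟨ContinuousLinearMap.adjoint S, ?_, fun f l => ?_⟩
  · rw [LinearIsometryEquiv.norm_map, hS]
    exact LinearMap.opNorm_extendOfNorm_le hdense hc hb
  · have hS : ∀ a, S (kernelVector H m l a)
        = kernelVector H m l (Matrix.toEuclideanLin (φ l)ᴴ a) := fun a => by
      have := LinearMap.extendOfNorm_eq hdense ⟨c, hb⟩ (Finsupp.single l a)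
      rw [← hS, he, hg, Finsupp.lsum_single, Finsupp.lsum_single] at this
      exact this
    have : WithLp.toLp 2 (vectorEval H m (ContinuousLinearMap.adjoint S f) l)
        = Matrix.toEuclideanLin (φ l) (WithLp.toLp 2 (vectorEval H m f l)) := by
      refine ext_inner_left ℂ fun a => ?_
      rw [← inner_kernelVector, ContinuousLinearMap.adjoint_inner_right, hS, inner_kernelVector,
        Matrix.toEuclideanLin_conjTranspose_eq_adjoint, LinearMap.adjoint_inner_left]
    exact congrArg WithLp.ofLp this

/-! ### Holomorphy of multipliers -/

/-- Near `x` the denominator `f` stays nonzero by continuity, so there `φ` is the quotient `h / f`.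
-/
theorem IsHolomorphic.of_mul {φ f h : U → ℂ} (hf : IsHolomorphic f) (hh : IsHolomorphic h) {x : U}
    (hx : f x ≠ 0) (heq : ∀ y, h y = φ y * f y) :
    ∃ F : (Fin d → ℂ) → ℂ, DifferentiableWithinAt ℂ F U x ∧
      ∀ᶠ y in nhdsWithin (x : Fin d → ℂ) U, ∀ hy : y ∈ U, F y = φ ⟨y, hy⟩ := by
  obtain ⟨A, hA, hAf⟩ := hf
  obtain ⟨B, hB, hBh⟩ := hh
  have hAx : A x ≠ 0 := by rwa [hAf]
  refine ⟨fun y => B y * (A y)⁻¹, (hB x x.2).fun_mul ((differentiableAt_inv hAx).comp_differentiableWithinAt _ (hA x x.2)), ?_⟩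
  filter_upwards [(hA x x.2).continuousWithinAt.eventually_ne hAx] with y hy hyU
  have h1 := hAf ⟨y, hyU⟩
  have h2 := hBh ⟨y, hyU⟩
  rw [heq] at h2
  simp only at h1 h2
  rw [h2, ← h1, mul_inv_cancel_right₀ hy]

theorem isHolomorphic_of_mul {φ : U → ℂ}
    (h : ∀ x : U, ∃ f : U → ℂ, IsHolomorphic f ∧ f x ≠ 0 ∧ IsHolomorphic fun y => φ y * f y) :
    IsHolomorphic φ := by
  classical
  refine ⟨fun y => if hy : y ∈ U then φ ⟨y, hy⟩ else 0, fun x hx => ?_, fun x => by simp⟩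
  obtain ⟨f, hf, hfx, hφf⟩ := h ⟨x, hx⟩
  obtain ⟨F, hF, hFφ⟩ := hf.of_mul hφf hfx fun _ => rfl
  refine hF.congr_of_eventuallyEq ?_ ?_
  · filter_upwards [hFφ, self_mem_nhdsWithin] with y hy hyU
    simp [hyU, hy]
  · simp [hx, hFφ.self_of_nhdsWithin hx hx]

/-- Multiplying the vector `e_s ⊗ k_x` by `φ` and taking the `r`-th component gives `φ_{rs} k_x`, a
holomorphic function; since `k_x(x) ≠ 0`, division by `k_x` is possible near `x`. -/
theorem isMatrixMultiplier_of_forall_exists (hhol : ∀ f : H, IsHolomorphic (fun l : U => f l))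
    (hne : ∀ l : U, reproducingKernel H l l ≠ 0) {φ : U → Matrix (Fin m) (Fin m) ℂ}
    (h : ∀ f : VectorSpaceOf H m, ∃ h : VectorSpaceOf H m,
      ∀ l : U, vectorEval H m h l = φ l *ᵥ vectorEval H m f l) :
    IsMatrixMultiplier H φ := by
  refine ⟨fun r s => isHolomorphic_of_mul fun x =>
    ⟨fun l => RKHS.kerFun H x (1 : ℂ) l, hhol _, hne x, ?_⟩, h⟩
  obtain ⟨g, hg⟩ := h (kernelVector H m x (EuclideanSpace.single s 1))
  convert hhol (g r) using 1
  funext l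
  have h1 := congrFun (hg l) r
  have h2 : vectorEval H m (kernelVector H m x (EuclideanSpace.single s 1)) l
      = Pi.single s (RKHS.kerFun H x (1 : ℂ) l) := by
    funext t
    change RKHS.kerFun H x (EuclideanSpace.single s (1 : ℂ) t) l = _
    by_cases hts : t = s
    · subst hts; simp
    · simp [hts]
  rw [h2] at h1
  have h3 : vectorEval H m g l r = g r l := rfl
  rw [← h3, h1]
  simp [Matrix.mulVec_single]

theorem exists_multiplier_of_adjointBound (hhol : ∀ f : H, IsHolomorphic (fun l : U => f l))
    (hne : ∀ l : U, reproducingKernel H l l ≠ 0) {φ : U → Matrix (Fin m) (Fin m) ℂ}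
    {c : ℝ} (hc : 0 ≤ c)
    (h : ∀ F : Finset U, AdjointBound H c (Subtype.val : F → U) (fun x => φ x)) :
    ∃ hφ : IsMatrixMultiplier H φ, ‖multiplicationOperator hφ‖ ≤ c := by
  obtain ⟨T, hT, hTφ⟩ := exists_operator_of_adjointBound hc h
  have hφ := isMatrixMultiplier_of_forall_exists hhol hne fun f => ⟨T f, hTφ f⟩
  refine ⟨hφ, ?_⟩
  have : multiplicationOperator hφ = T := by
    ext1 f
    refine vectorEval_injective (U := U) H m (funext fun l => ?_)
    rw [multiplicationOperator_apply, hTφ]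
  rwa [this]

/-! ### Norms of discrete operators as adjoint bounds -/

theorem isDiscreteKernel_of_injective (hpos : (Matrix.of (reproducingKernel (U := U) H)).PosDef)
    {n : ℕ} {l : Fin n → U} (hl : Function.Injective l) :
    IsDiscreteKernel fun i j : Fin n => reproducingKernel H (l i) (l j) where
  posSemidef := (hpos.submatrix hl).posSemidef
  posDef := hpos.submatrix (hl.comp Subtype.val_injective)

theorem norm_discreteSpace {n : ℕ} {l : Fin n → U}
    (hg : IsDiscreteKernel fun i j : Fin n => reproducingKernel H (l i) (l j)) (I : Set (Fin n))
    (c : DiscreteSpace hg m I) :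
    ‖c‖ = ‖∑ i, kernelVector H m (l i.1) (c i)‖ := by
  rw [← sq_eq_sq₀ (norm_nonneg _) (norm_nonneg _), ← Complex.ofReal_inj]
  rw [norm_sq_sum_kernelVector (fun i : SupportIn _ I => l i.1) c, Finset.sum_comm,
    Complex.ofReal_pow]
  exact (inner_self_eq_norm_sq_to_K (𝕜 := ℂ) c).symm

theorem norm_discreteOperator_le_iff {n : ℕ} {l : Fin n → U}
    (hg : IsDiscreteKernel fun i j : Fin n => reproducingKernel H (l i) (l j)) {I : Set (Fin n)}
    (z : I → Matrix (Fin m) (Fin m) ℂ) {c : ℝ} (hc : 0 ≤ c) :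
    ‖discreteOperator hg z‖ ≤ c ↔
      AdjointBound H c
        (fun i : SupportIn (fun i j => reproducingKernel H (l i) (l j)) I => l i.1)
        (fun i => z ⟨i.1, i.2.1⟩) := by
  rw [ContinuousLinearMap.opNorm_le_iff hc]
  refine forall_congr' fun a => ?_
  rw [norm_discreteSpace, norm_discreteSpace]
  rfl

theorem AdjointBound.of_comp_equiv {ι κ : Type*} [Fintype ι] [Fintype κ] {c : ℝ} {l : ι → U}
    {z : ι → Matrix (Fin m) (Fin m) ℂ} (e : κ ≃ ι) (h : AdjointBound H c (l ∘ e) (z ∘ e)) :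
    AdjointBound H c l z := by
  have := h.comp_injective e.symm.injective
  simpa [Function.comp_assoc] using this

theorem norm_discreteOperator_le_iff_of_ne_zero
    (hne : ∀ x : U, reproducingKernel H x x ≠ 0) {n : ℕ} {l : Fin n → U}
    (hg : IsDiscreteKernel fun i j : Fin n => reproducingKernel H (l i) (l j)) {I : Set (Fin n)}
    [Fintype I] (z : I → Matrix (Fin m) (Fin m) ℂ) {c : ℝ} (hc : 0 ≤ c) :
    ‖discreteOperator hg z‖ ≤ c ↔ AdjointBound H c (fun i : I => l i) z := by
  rw [norm_discreteOperator_le_iff hg _ hc]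
  let e : SupportIn (fun i j => reproducingKernel H (l i) (l j)) I ≃ I :=
    Equiv.subtypeEquivRight fun i => ⟨fun hi => hi.1, fun hi => ⟨hi, hne (l i)⟩⟩
  refine ⟨fun h => AdjointBound.of_comp_equiv e h, fun h => ?_⟩
  have := h.comp_injective e.injective
  exact this

theorem norm_discreteOperator_univ_le_iff
    (hne : ∀ x : U, reproducingKernel H x x ≠ 0) {n : ℕ} {l : Fin n → U}
    (hg : IsDiscreteKernel fun i j : Fin n => reproducingKernel H (l i) (l j))
    (z : Fin n → Matrix (Fin m) (Fin m) ℂ) {c : ℝ} (hc : 0 ≤ c) :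
    ‖discreteOperator hg (fun i : (Set.univ : Set (Fin n)) => z i)‖ ≤ c ↔
      AdjointBound H c l z := by
  rw [norm_discreteOperator_le_iff_of_ne_zero hne hg _ hc]
  refine ⟨fun h => AdjointBound.of_comp_equiv (Equiv.Set.univ (Fin n)) h, fun h => ?_⟩
  have := h.comp_injective (Equiv.Set.univ (Fin n)).injective
  exact this

theorem norm_kernelVector (l : U) (a : EuclideanSpace ℂ (Fin m)) :
    ‖kernelVector H m l a‖ = √‖reproducingKernel H l l‖ * ‖a‖ := by
  rw [← sq_eq_sq₀ (norm_nonneg _) (by positivity), mul_pow, Real.sq_sqrt (norm_nonneg _)]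
  have := congrArg norm (inner_kernelVector_kernelVector (H := H) l l a a)
  rw [inner_self_eq_norm_sq_to_K, inner_self_eq_norm_sq_to_K] at this
  simpa using this

/-- At the single node `i` the factor `‖k_{l i}‖` cancels, leaving `‖(z i)ᴴ e_r‖ ≤ c`, and the
`s`-th coordinate of `(z i)ᴴ e_r` is the conjugate of `z i r s`. This supplies the uniform entry
bound used for compactness. -/
theorem AdjointBound.norm_apply_le (hne : ∀ x : U, reproducingKernel H x x ≠ 0) {ι : Type*}
    [Fintype ι] {c : ℝ} {l : ι → U} {z : ι → Matrix (Fin m) (Fin m) ℂ} (h : AdjointBound H c l z)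
    (i : ι) (r s : Fin m) : ‖z i r s‖ ≤ c := by
  have h1 := h.comp_injective (e := fun _ : Unit => i) (fun _ _ _ => rfl)
    fun _ => EuclideanSpace.single r 1
  simp only [Finset.univ_unique, Finset.sum_singleton, Function.comp_apply, norm_kernelVector,
    PiLp.norm_single, norm_one, mul_one] at h1
  have hk : 0 < √‖reproducingKernel H (l i) (l i)‖ := Real.sqrt_pos.2 (norm_pos_iff.2 (hne _))
  rw [mul_comm, mul_le_mul_iff_left₀ hk] at h1
  refine le_trans ?_ ((PiLp.norm_apply_le _ s).trans h1)
  simp [Matrix.toLpLin_apply]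

/-! ### Norm-preserving extension and the discrete condition -/

/-- The strict inequality `c < c'` selects an actual extension, without requiring that the infimum
be attained. -/
theorem exists_extension_of_isDiscreteInterpolationKernel
    (hne : ∀ x : U, reproducingKernel H x x ≠ 0) {n : ℕ} {l : Fin n → U}
    (hd : IsDiscreteInterpolationKernel (fun i j => reproducingKernel H (l i) (l j)) m)
    {I : Set (Fin n)} [Fintype I] {z : I → Matrix (Fin m) (Fin m) ℂ} {c c' : ℝ} (hc : 0 ≤ c)
    (hcc' : c < c') (hz : AdjointBound H c (fun i : I => l i) z) :
    ∃ w : Fin n → Matrix (Fin m) (Fin m) ℂ, (∀ i : I, w i = z i) ∧ AdjointBound H c' l w := by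
  obtain ⟨hg, hd⟩ := hd
  have h1 : ‖discreteOperator hg z‖ ≤ c :=
    (norm_discreteOperator_le_iff_of_ne_zero hne hg z hc).2 hz
  have : Nonempty {w : Fin n → Matrix (Fin m) (Fin m) ℂ // ∀ i : I, w i = z i} := by
    classical
    exact ⟨fun i => if h : i ∈ I then z ⟨i, h⟩ else 0, fun i => by simp⟩
  obtain ⟨w, hw⟩ := exists_lt_of_ciInf_lt ((hd I z).symm.trans_lt (h1.trans_lt hcc'))
  exact ⟨w.1, w.2,
    (norm_discreteOperator_univ_le_iff hne hg w.1 (hc.trans hcc'.le)).1 hw.le⟩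

theorem isDiscreteInterpolationKernel_of_exists_extension
    (hne : ∀ x : U, reproducingKernel H x x ≠ 0) {n : ℕ} {l : Fin n → U}
    (hg : IsDiscreteKernel fun i j : Fin n => reproducingKernel H (l i) (l j))
    (h : ∀ (I : Set (Fin n)) [Fintype I] (z : I → Matrix (Fin m) (Fin m) ℂ) (c : ℝ), 0 < c →
      AdjointBound H c (fun i : I => l i) z →
      ∃ w : Fin n → Matrix (Fin m) (Fin m) ℂ, (∀ i : I, w i = z i) ∧ AdjointBound H c l w) :
    IsDiscreteInterpolationKernel (fun i j => reproducingKernel H (l i) (l j)) m := by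
  classical
  refine ⟨hg, fun I z => ?_⟩
  have : Fintype I := Fintype.ofFinite _
  have : Nonempty {w : Fin n → Matrix (Fin m) (Fin m) ℂ // ∀ i : I, w i = z i} :=
    ⟨fun i => if h : i ∈ I then z ⟨i, h⟩ else 0, fun i => by simp⟩
  -- One inequality is restriction from `N` to `I`, which cannot increase the norm. For the other,
  -- bounds `c` strictly above `‖T_{g,z}‖` suffice; they are positive, so the extension hypothesis
  -- applies.
  refine le_antisymm (le_ciInf fun w => ?_) (le_of_forall_gt_imp_ge_of_dense fun c hc => ?_)
  · rw [norm_discreteOperator_le_iff_of_ne_zero hne hg z (norm_nonneg _)]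
    have := ((norm_discreteOperator_univ_le_iff hne hg w.1 (norm_nonneg _)).1 le_rfl).comp_injective
      (Subtype.val_injective (p := (· ∈ I)))
    rwa [show w.1 ∘ Subtype.val = z from funext w.2] at this
  · have hc0 : 0 < c := (norm_nonneg _).trans_lt hc
    obtain ⟨w, hwz, hw⟩ := h I z c hc0 ((norm_discreteOperator_le_iff_of_ne_zero hne hg z hc0.le).1 hc.le)
    refine ciInf_le_of_le ⟨0, ?_⟩ ⟨w, hwz⟩
      ((norm_discreteOperator_univ_le_iff hne hg w hc0.le).2 hw)
    rintro _ ⟨_, rfl⟩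
    exact norm_nonneg _

theorem isDiscreteInterpolationKernel_of_isHolomorphicInterpolationKernel
    (hpos : (Matrix.of (reproducingKernel (U := U) H)).PosDef)
    (hne : ∀ x : U, reproducingKernel H x x ≠ 0)
    (hk : IsHolomorphicInterpolationKernel (U := U) H m) {n : ℕ} {l : Fin n → U}
    (hl : Function.Injective l) :
    IsDiscreteInterpolationKernel (fun i j => reproducingKernel H (l i) (l j)) m := by
  refine isDiscreteInterpolationKernel_of_exists_extension hne
    (isDiscreteKernel_of_injective hpos hl) fun I _ z c hc hz => ?_
  -- Holomorphic interpolation speaks only of a positive number of nodes; for empty `I` the zero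
  -- function extends.
  rcases isEmpty_or_nonempty I with hI | hI
  · exact ⟨0, fun i => hI.elim i, fun a => by simp; positivity⟩
  let e := (Fintype.equivFin I).symm
  -- Scaling by `c⁻¹` brings the data to norm at most `1`, where the Pick condition applies; the
  -- multiplier is scaled back by `c` afterwards.
  have hz' := (hz.smul (inv_nonneg.2 hc.le)).comp_injective e.injective
  rw [inv_mul_cancel₀ hc.ne', ← pickMatrix_posSemidef_iff] at hz'
  obtain ⟨φ, hφ, hφ1, hφz⟩ := (hk _ Fintype.card_pos _
    (hl.comp (Subtype.val_injective.comp e.injective)) _).2 hz'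
  have hb : AdjointBound H 1 l (φ ∘ l) := fun a =>
    (adjointBound_of_multiplier hφ l a).trans (mul_le_mul_of_nonneg_right hφ1 (norm_nonneg _))
  refine ⟨fun i => (c : ℂ) • φ (l i), fun i => ?_, by simpa using hb.smul hc.le⟩
  have hi := hφz (e.symm i)
  simp only [Function.comp_apply, Equiv.apply_symm_apply] at hi
  change (c : ℂ) • φ (l i) = z i
  rw [hi, smul_smul, ← Complex.ofReal_mul, mul_inv_cancel₀ hc.ne', Complex.ofReal_one, one_smul]

/-! ### Extension to the whole domain by compactness -/

theorem exists_extension_to_finset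
    (hne : ∀ x : U, reproducingKernel H x x ≠ 0)
    (hd : ∀ n : ℕ, 0 < n → ∀ l : Fin n → U, Function.Injective l →
      IsDiscreteInterpolationKernel (fun i j => reproducingKernel H (l i) (l j)) m)
    {n : ℕ} {l : Fin n → U} (hl : Function.Injective l) {z : Fin n → Matrix (Fin m) (Fin m) ℂ}
    {c c' : ℝ} (hc : 0 ≤ c) (hcc' : c < c') (hz : AdjointBound H c l z) (F : Finset U) :
    ∃ φ : U → Matrix (Fin m) (Fin m) ℂ, (∀ i, φ (l i) = z i) ∧
      (∀ x r s, ‖φ x r s‖ ≤ c') ∧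
      AdjointBound H c' (Subtype.val : F → U) (fun x => φ x) := by
  classical
  -- The discrete condition is applied on `G`, which contains both the nodes and `F`, with the nodes
  -- in the role of `I`; the result is then restricted to `F`.
  let G : Finset U := F ∪ Finset.univ.image l
  have hlG : ∀ i, l i ∈ G := fun i =>
    Finset.mem_union_right _ (Finset.mem_image_of_mem l (Finset.mem_univ i))
  rcases G.eq_empty_or_nonempty with hG | hG
  · have hn : ∀ i : Fin n, False := fun i => by simpa [hG] using hlG i
    have hF : F = ∅ := (Finset.union_eq_empty.1 hG).1
    subst hF
    exact ⟨0, fun i => (hn i).elim, fun x r s => by simpa using (hc.trans hcc'.le),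
      fun a => by simp⟩
  let e : Fin G.card ≃ G := G.equivFin.symm
  have hinj : Function.Injective fun i => (e i : U) := Subtype.val_injective.comp e.injective
  let q : Fin n → Fin G.card := fun i => e.symm ⟨l i, hlG i⟩
  have hq : Function.Injective q := fun i j hij =>
    hl (congrArg Subtype.val (e.symm.injective hij))
  let f : Fin n ≃ Set.range q := Equiv.ofInjective q hq
  have hfe : ∀ i, (e (f i) : U) = l i := fun i => by simp [f, q, Equiv.ofInjective_apply]
  have hz' : AdjointBound H c (fun i : Set.range q => (e i : U)) (z ∘ f.symm) := by
    refine AdjointBound.of_comp_equiv f ?_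
    have h1 : (fun i : Set.range q => (e i : U)) ∘ f = l := funext hfe
    have h2 : (z ∘ f.symm) ∘ f = z := by funext i; simp
    rwa [h1, h2]
  obtain ⟨w, hwz, hw⟩ := exists_extension_of_isDiscreteInterpolationKernel hne
    (hd _ hG.card_pos _ hinj) hc hcc' hz'
  have hφ : ∀ x (hx : x ∈ G), (fun x => if hx : x ∈ G then w (e.symm ⟨x, hx⟩) else 0) x
      = w (e.symm ⟨x, hx⟩) := fun x hx => by simp [hx]
  -- The value `0` off `G` keeps every entry of `φ` within `c'` on all of `U`, so that `φ` lies in a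
  -- product of closed balls.
  refine ⟨fun x => if hx : x ∈ G then w (e.symm ⟨x, hx⟩) else 0, fun i => ?_, fun x r s => ?_, ?_⟩
  · rw [hφ _ (hlG i)]
    have := hwz (f i)
    simpa [f, q, Equiv.ofInjective_apply] using this
  · by_cases hx : x ∈ G
    · simpa [hx] using hw.norm_apply_le hne _ r s
    · simpa [hx] using (hc.trans hcc'.le)
  · let p : F → Fin G.card := fun x => e.symm ⟨x, Finset.mem_union_left _ x.2⟩
    have hp : Function.Injective p := fun x y hxy =>
      Subtype.ext (congrArg (fun x : G => (x : U)) (e.symm.injective hxy))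
    have h1 := hw.comp_injective hp
    have h2 : (fun i => (e i : U)) ∘ p = Subtype.val := by funext x; simp [p]
    rw [h2] at h1
    convert h1 using 2 with x
    exact hφ _ _

/-- For each fixed `a` the bound is a closed inequality in the finitely many values `φ (l i)`, on
which the left side depends continuously in the product topology. -/
theorem isClosed_adjointBound (H : Type*) [NormedAddCommGroup H]
    [InnerProductSpace ℂ H] [CompleteSpace H] [RKHS ℂ H U ℂ] {ι : Type*} [Fintype ι] (c : ℝ)
    (l : ι → U) :
    IsClosed {φ : U → Matrix (Fin m) (Fin m) ℂ | AdjointBound H c l fun i => φ (l i)} := by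
  simp only [AdjointBound, Set.ofPred_forall]
  refine isClosed_iInter fun a => isClosed_le ?_ continuous_const
  refine continuous_norm.comp (continuous_finsetSum _ fun i _ => ?_)
  refine (LinearMap.continuous_of_finiteDimensional (kernelVector H m (l i))).comp ?_
  simp only [Matrix.toLpLin_apply]
  fun_prop

theorem exists_extension_to_domain
    (hne : ∀ x : U, reproducingKernel H x x ≠ 0)
    (hd : ∀ n : ℕ, 0 < n → ∀ l : Fin n → U, Function.Injective l →
      IsDiscreteInterpolationKernel (fun i j => reproducingKernel H (l i) (l j)) m)
    {n : ℕ} {l : Fin n → U} (hl : Function.Injective l) {z : Fin n → Matrix (Fin m) (Fin m) ℂ}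
    {c : ℝ} (hc : 0 ≤ c) (hz : AdjointBound H c l z) :
    ∃ φ : U → Matrix (Fin m) (Fin m) ℂ, (∀ i, φ (l i) = z i) ∧
      ∀ F : Finset U, AdjointBound H c (Subtype.val : F → U) (fun x => φ x) := by
  classical
  -- The largest loss is `ε 0 = 1`, so balls of radius `c + 1` contain the entries of all the
  -- extensions.
  let ε : ℕ → ℝ := fun k => 1 / ((k : ℝ) + 1)
  have hε : ∀ k, 0 < ε k := fun k => Nat.one_div_pos_of_nat
  have hanti : Antitone ε := fun j k h => Nat.one_div_le_one_div h
  let K : Set (U → Matrix (Fin m) (Fin m) ℂ) :=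
    Set.univ.pi fun _ => Set.univ.pi fun _ => Set.univ.pi fun _ => Metric.closedBall 0 (c + 1)
  have hK : IsCompact K := isCompact_univ_pi fun _ => isCompact_univ_pi fun _ =>
    isCompact_univ_pi fun _ => isCompact_closedBall _ _
  let t : Finset U × ℕ → Set (U → Matrix (Fin m) (Fin m) ℂ) := fun p =>
    K ∩ ({φ | ∀ i, φ (l i) = z i} ∩
      {φ | AdjointBound H (c + ε p.2) (Subtype.val : p.1 → U) (fun x => φ x)})
  have htcl : ∀ p, IsClosed (t p) := fun p => by
    refine hK.isClosed.inter (IsClosed.inter ?_ ?_)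
    · simp only [Set.ofPred_forall]
      exact isClosed_iInter fun i => isClosed_eq (continuous_apply _) continuous_const
    · exact isClosed_adjointBound H (c + ε p.2) (Subtype.val : p.1 → U)
  have htn : ∀ p, (t p).Nonempty := fun p => by
    obtain ⟨φ, h1, h2, h3⟩ := exists_extension_to_finset hne hd hl hc
      (lt_add_of_pos_right c (hε p.2)) hz p.1
    refine ⟨φ, fun x _ r _ s _ => ?_, h1, h3⟩
    rw [mem_closedBall_zero_iff]
    refine (h2 x r s).trans (add_le_add_right ((hanti (Nat.zero_le p.2)).trans ?_) c)
    simp [ε]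
  -- A larger finite set and a smaller loss give a stronger condition, so the family is directed and
  -- its intersection is nonempty by compactness.
  have hta : Antitone t := fun p q hpq φ ⟨h1, h2, h3⟩ => by
    refine ⟨h1, h2, fun a => ?_⟩
    have h4 := h3.comp_injective (e := Set.inclusion (Finset.coe_subset.2 hpq.1))
      (Set.inclusion_injective _)
    exact (h4 a).trans
      (mul_le_mul_of_nonneg_right (add_le_add_right (hanti hpq.2) c) (norm_nonneg _))
  obtain ⟨φ, hφ⟩ := IsCompact.nonempty_iInter_of_directed_nonempty_isCompact_isClosed t
    hta.directed_ge htn (fun p => hK.of_isClosed_subset (htcl p) Set.inter_subset_left) htcl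
  rw [Set.mem_iInter] at hφ
  refine ⟨φ, (hφ (∅, 0)).2.1, fun F a => ?_⟩
  -- With `F` and `a` fixed, the loss `ε k` tends to `0`, which restores the constant `c`.
  refine ge_of_tendsto' (f := fun k : ℕ => (c + ε k) * _) (x := Filter.atTop) ?_
    fun k => (hφ (F, k)).2.2 a
  have := ((tendsto_one_div_add_atTop_nhds_zero_nat (𝕜 := ℝ)).const_add c).mul_const
    ‖∑ i : F, kernelVector H m (i : U) (a i)‖
  rwa [add_zero] at this

end KernelVector

theorem proposition3p2 {d : ℕ} (U : Set (Fin d → ℂ)) (hU_open : IsOpen U)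
    (hU_conn : IsConnected U) (hU_bdd : Bornology.IsBounded U)
    (H : Type*) [NormedAddCommGroup H] [InnerProductSpace ℂ H] [CompleteSpace H] [RKHS ℂ H U ℂ]
    (hH : IsRegularSpace (U := U) H) (m : ℕ) (hm : 0 < m) :
    IsHolomorphicInterpolationKernel (U := U) H m ↔
      ∀ n : ℕ, 0 < n → ∀ l : Fin n → U, Function.Injective l →
        IsDiscreteInterpolationKernel
          (fun i j : Fin n => reproducingKernel H (l i) (l j)) m := by
  have hne : ∀ x : U, reproducingKernel H x x ≠ 0 := fun x => by
    -- The quadratic form of the kernel at the unit mass at `x` is `k_x(x)`.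
    have := hH.posDef.2 (x := Finsupp.single x 1) (by simp)
    simpa using this.ne'
  constructor
  · exact fun hk n _ l hl =>
      isDiscreteInterpolationKernel_of_isHolomorphicInterpolationKernel hH.posDef hne hk hl
  · refine fun hd n _ l hl z => ⟨?_, fun hz => ?_⟩
    · rintro ⟨φ, hφ, hφ1, hφz⟩
      rw [pickMatrix_posSemidef_iff, ← show φ ∘ l = z from funext hφz]
      exact fun a => (adjointBound_of_multiplier hφ l a).trans
        (mul_le_mul_of_nonneg_right hφ1 (norm_nonneg _))
    · rw [pickMatrix_posSemidef_iff] at hz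
      obtain ⟨φ, hφz, hφ⟩ := exists_extension_to_domain hne hd hl zero_le_one hz
      obtain ⟨hφ', h1⟩ := exists_multiplier_of_adjointBound hH.holomorphic hne zero_le_one hφ
      exact ⟨φ, hφ', h1, hφz⟩
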